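/- **Theorem (Darboux's theorem for holomorphic symplectic manifolds).** Let $n\in\mathbb{N}$ and let $(X,\Omega)$ be a holomorphic symplectic manifold of complex dimension $\dim_{\mathbb{C}} X = 2n$; that is, $X$ is a complex manifold with charts in $\mathbb{C}^{2n}$, and $\Omega$ is a holomorphic $2$-form on $X$ which is closed, $d\Omega = 0$, and non-degenerate on the $(1,0)$-tangent bundle: for every $x\in X$ and every $V\in T^{(1,0)}_xX\setminus\{0\}$ there is $W\in T^{(1,0)}_xX$ with $\Omega_x(V,W)\neq 0$. Then for every point $x\in X$ there is a holomorphic chart $\psi = (Q_1,\ldots,Q_n,P_1,\ldots,P_n): U\to V\subset\mathbb{C}^{2n}$ of $X$ with $x\in U$ such that $$\Omega|_U = \sum_{j=1}^n dP_j\wedge dQ_j .$$ -/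

import Mathlib

open scoped Manifold ContDiff Topology

/-- The complex coordinate space `ℂ ^ m`. -/
abbrev CSpace (m : ℕ) : Type := EuclideanSpace ℂ (Fin m)

/-- The wedge product of two complex linear forms, `(α ∧ β)(v, w) = α v * β w - α w * β v`
(see `wedge_apply`). -/
noncomputable def wedge {V : Type*} [AddCommGroup V] [Module ℂ V] [TopologicalSpace V]
    (α β : V →L[ℂ] ℂ) : V [⋀^Fin 2]→L[ℂ] ℂ where
  toFun v := α (v 0) * β (v 1) - α (v 1) * β (v 0)
  map_update_add' v i x y := by
    fin_cases i <;> simp [Function.update] <;> ring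
  map_update_smul' v i c x := by
    fin_cases i <;> simp [Function.update] <;> ring
  map_eq_zero_of_eq' v i j hv hij := by
    fin_cases i <;> fin_cases j <;> simp_all
  cont := by fun_prop

theorem wedge_apply {V : Type*} [AddCommGroup V] [Module ℂ V] [TopologicalSpace V]
    (α β : V →L[ℂ] ℂ) (v w : V) : wedge α β ![v, w] = α v * β w - α w * β v := rfl

/-- The holomorphic charts of the complex manifold `X`: all homeomorphisms from an open subset
of `X` onto an open subset of `ℂ ^ m` whose transition maps with the charts of the given atlas
are holomorphic in both directions. (Over `ℂ`, holomorphic is the same as analytic, which is the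
smoothness class `ω`.) -/
def holomorphicCharts (m : ℕ) (X : Type*) [TopologicalSpace X] [ChartedSpace (CSpace m) X] :
    Set (OpenPartialHomeomorph X (CSpace m)) :=
  IsManifold.maximalAtlas 𝓘(ℂ, CSpace m) ω X

/-- A `2`-form of type `(2, 0)` on a complex manifold `X` of dimension `m`, with no regularity.

The space `TangentSpace 𝓘(ℂ, CSpace m) x` is the real tangent space `T_x X` with
multiplication by `i` given by the complex structure `J`. It is identified with `T_x^{(1,0)} X`
through the complex linear isomorphism `v ↦ (v - i J v) / 2`, and a `(2, 0)`-form at `x` (which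
is zero as soon as one argument lies in `T_x^{(0,1)} X`) is the same as an alternating complex
bilinear form on this space. -/
abbrev TwoForm (m : ℕ) (X : Type*) [TopologicalSpace X] [ChartedSpace (CSpace m) X] :=
  ∀ x : X, TangentSpace 𝓘(ℂ, CSpace m) x [⋀^Fin 2]→L[ℂ] ℂ

/-- The expression of a `2`-form in the chart `φ`, i.e. its pullback under `φ⁻¹`. It is only
meaningful on the open set `φ.target`. -/
noncomputable def TwoForm.inChart {m : ℕ} {X : Type*} [TopologicalSpace X]
    [ChartedSpace (CSpace m) X] (Ω : TwoForm m X) (φ : OpenPartialHomeomorph X (CSpace m))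
    (z : CSpace m) : CSpace m [⋀^Fin 2]→L[ℂ] ℂ :=
  (Ω (φ.symm z)).compContinuousLinearMap
    ((mfderiv 𝓘(ℂ, CSpace m) 𝓘(ℂ, CSpace m) φ.symm z).comp
      (NormedSpace.fromTangentSpace (𝕜 := ℂ) z).symm.toContinuousLinearMap)

/-- `Ω` is a holomorphic symplectic `2`-form on the complex manifold `X`. -/
structure IsHolomorphicSymplectic {m : ℕ} {X : Type*} [TopologicalSpace X]
    [ChartedSpace (CSpace m) X] (Ω : TwoForm m X) : Prop where
  /-- In every holomorphic chart the coefficients of `Ω` are holomorphic. -/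
  holomorphic : ∀ φ ∈ holomorphicCharts m X, AnalyticOnNhd ℂ (Ω.inChart φ) φ.target
  /-- `d Ω = 0`, computed in holomorphic charts. -/
  closed : ∀ φ ∈ holomorphicCharts m X, ∀ z ∈ φ.target, extDeriv (Ω.inChart φ) z = 0
  /-- `Ω` is non-degenerate on the holomorphic tangent spaces. -/
  nondegenerate : ∀ (x : X) (v : TangentSpace 𝓘(ℂ, CSpace m) x), v ≠ 0 →
    ∃ w : TangentSpace 𝓘(ℂ, CSpace m) x, Ω x ![v, w] ≠ 0

/-- The first `n` components `Q_1, …, Q_n` of a map `ψ = (Q_1, …, Q_n, P_1, …, P_n)` into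
`ℂ ^ (2 n)`. -/
def coordQ {n : ℕ} {X : Type*} (ψ : X → CSpace (2 * n)) (j : Fin n) (x : X) : ℂ :=
  ψ x ⟨j, by omega⟩

/-- The last `n` components `P_1, …, P_n` of a map `ψ = (Q_1, …, Q_n, P_1, …, P_n)` into
`ℂ ^ (2 n)`. -/
def coordP {n : ℕ} {X : Type*} (ψ : X → CSpace (2 * n)) (j : Fin n) (x : X) : ℂ :=
  ψ x ⟨n + j, by omega⟩

/-! The proof is Moser's trick, carried out holomorphically. In a chart centred at the point, let
`B` be the form, `B 0` its value at the origin and `β = B - B 0`. Then `β` is closed and vanishes at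
`0`, so `β = dα` with `α` vanishing to second order (`exists_primitive`). By non-degeneracy, the
equation `ι_X (B 0 + t β) = -α` has a solution `X_t` near `0` for all `t` in `[0, 1]`. Since `B 0 +
t β` is closed, its Lie derivative along `X_t` is `-dα = -β`, so its pullback along the flow of
`X_t` does not depend on `t` (`moser_identity`, `moser_invariant`). Hence the time-one flow pulls
`B` back to the constant form `B 0`, and a linear symplectic basis (`exists_sum_wedge`) brings `B 0`
to standard form.

The flow must depend holomorphically on its starting point. It is obtained as the solution of `γ = x
+ ∫ N γ` in the Banach space of continuous curves on `[0, 1]`, where `(N γ) t = X_t (γ t)`.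
Composition with an analytic function is an analytic operator on curves (`analyticAt_superpose`),
hence so is `N`. Because `α` vanishes to second order, `N` has zero derivative at the zero curve, so
the analytic inverse function theorem applies to `γ ↦ γ - ∫ N γ` (`exists_analytic_flow`). Time
stays real; only the space variable is complex. -/

/-! ### Analyticity of superposition operators on continuous maps -/

section Superposition

open Classical in
/-- The superposition operator `γ ↦ f ∘ γ` on continuous maps, with value `0` where `f ∘ γ` is
not continuous. -/
noncomputable def superpose (K : Type*) [TopologicalSpace K] {E F : Type*} [TopologicalSpace E]
    [TopologicalSpace F] [Zero F] (f : E → F) (γ : C(K, E)) : C(K, F) :=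
  if h : Continuous (f ∘ γ) then ⟨f ∘ γ, h⟩ else 0

theorem superpose_apply {K E F : Type*} [TopologicalSpace K] [TopologicalSpace E]
    [TopologicalSpace F] [Zero F] {f : E → F} {γ : C(K, E)} (h : Continuous (f ∘ γ)) (t : K) :
    superpose K f γ t = f (γ t) := by
  simp [superpose, h]

variable {𝕜 : Type*} [NontriviallyNormedField 𝕜] {K : Type*} [TopologicalSpace K] [CompactSpace K]
  {E F : Type*} [NormedAddCommGroup E] [NormedSpace 𝕜 E] [NormedAddCommGroup F] [NormedSpace 𝕜 F]

/-- A continuous multilinear map acts pointwise on tuples of continuous maps. -/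
noncomputable def pointwiseMultilinear (K : Type*) [TopologicalSpace K] [CompactSpace K] {n : ℕ}
    (p : E [×n]→L[𝕜] F) : C(K, E) [×n]→L[𝕜] C(K, F) :=
  MultilinearMap.mkContinuous
    { toFun := fun γ ↦ ⟨fun t ↦ p fun i ↦ γ i t, p.cont.comp (by fun_prop)⟩
      map_update_add' := by
        intro _ γ i a b
        ext t
        have h (c : C(K, E)) : (fun j ↦ Function.update γ i c j t)
            = Function.update (fun j ↦ γ j t) i (c t) := by
          ext j; by_cases hj : j = i
          · subst hj; simp
          · simp [hj]
        simp only [ContinuousMap.coe_mk, ContinuousMap.add_apply, h]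
        exact p.map_update_add _ _ _ _
      map_update_smul' := by
        intro _ γ i a b
        ext t
        have h (c : C(K, E)) : (fun j ↦ Function.update γ i c j t)
            = Function.update (fun j ↦ γ j t) i (c t) := by
          ext j; by_cases hj : j = i
          · subst hj; simp
          · simp [hj]
        simp only [ContinuousMap.coe_mk, ContinuousMap.smul_apply, h]
        exact p.map_update_smul _ _ _ _ }
    ‖p‖ (by
      intro γ
      refine (ContinuousMap.norm_le _ (by positivity)).2 fun t ↦ (p.le_opNorm _).trans ?_
      gcongr with i
      exact (γ i).norm_coe_le_norm t)

theorem norm_pointwiseMultilinear_le {n : ℕ} (p : E [×n]→L[𝕜] F) :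
    ‖pointwiseMultilinear K p‖ ≤ ‖p‖ :=
  MultilinearMap.mkContinuous_norm_le _ (norm_nonneg _) _

theorem continuous_comp_of_norm_lt {f : E → F} {p : FormalMultilinearSeries 𝕜 E F} {x₀ : E}
    {r : ENNReal} (hf : HasFPowerSeriesOnBall f p x₀ r) {γ : C(K, E)}
    (hγ : γ ∈ Metric.eball (ContinuousMap.const K x₀) r) : Continuous (f ∘ γ) := by
  refine hf.continuousOn.comp_continuous γ.continuous fun t ↦ ?_
  rw [Metric.mem_eball, edist_eq_enorm_sub] at hγ ⊢
  refine lt_of_le_of_lt ?_ hγ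
  simp only [enorm_le_iff_norm_le]
  exact (γ - ContinuousMap.const K x₀).norm_coe_le_norm t

/-- The power series of `f` acts pointwise on curves without increasing the norms of its
coefficients, so it still converges for the sup norm. Evaluation at each `t` identifies its sum with
`f ∘ γ`. -/
theorem hasFPowerSeriesOnBall_superpose [CompleteSpace F] {f : E → F}
    {p : FormalMultilinearSeries 𝕜 E F} {x₀ : E} {r : ENNReal}
    (hf : HasFPowerSeriesOnBall f p x₀ r) :
    HasFPowerSeriesOnBall (superpose K f) (fun n ↦ pointwiseMultilinear K (p n))
      (ContinuousMap.const K x₀) r := by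
  have hr : r ≤ FormalMultilinearSeries.radius (𝕜 := 𝕜) (E := C(K, E)) (F := C(K, F))
      (fun n ↦ pointwiseMultilinear K (p n)) := by
    refine hf.r_le.trans (ENNReal.le_of_forall_nnreal_lt fun s hs ↦ ?_)
    obtain ⟨C, -, hC⟩ := p.norm_mul_pow_le_of_lt_radius hs
    refine FormalMultilinearSeries.le_radius_of_bound _ C fun n ↦ le_trans ?_ (hC n)
    gcongr
    exact norm_pointwiseMultilinear_le _
  refine ⟨hr, hf.r_pos, fun {η} hη ↦ ?_⟩
  have hs := FormalMultilinearSeries.summable_norm_apply _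
    (Metric.eball_subset_eball hr hη)
  obtain ⟨g, hg⟩ := hs.of_norm
  convert hg
  ext t
  have h1 := ContinuousMap.hasSum_apply hg t
  have hc : Continuous (f ∘ (ContinuousMap.const K x₀ + η : C(K, E))) := by
    apply continuous_comp_of_norm_lt hf
    simpa [Metric.mem_eball, edist_eq_enorm_sub] using hη
  rw [superpose_apply hc]
  refine HasSum.unique (hf.hasSum (y := η t) ?_) h1
  rw [Metric.mem_eball, edist_eq_enorm_sub, sub_zero] at hη ⊢
  refine lt_of_le_of_lt ?_ hη
  simp only [enorm_le_iff_norm_le]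
  exact η.norm_coe_le_norm t

theorem analyticAt_superpose [CompleteSpace F] {f : E → F} {x₀ : E} (hf : AnalyticAt 𝕜 f x₀) :
    AnalyticAt 𝕜 (superpose K f) (ContinuousMap.const K x₀) := by
  obtain ⟨p, r, h⟩ := hf
  exact ⟨_, r, hasFPowerSeriesOnBall_superpose h⟩

theorem eventually_superpose_apply {f : E → F} {x₀ : E} (hf : AnalyticAt 𝕜 f x₀) :
    ∀ᶠ γ in 𝓝 (ContinuousMap.const K x₀), ∀ t, superpose K f γ t = f (γ t) := by
  obtain ⟨p, r, h⟩ := hf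
  filter_upwards [Metric.eball_mem_nhds _ h.r_pos] with γ hγ
  exact superpose_apply (continuous_comp_of_norm_lt h hγ)

theorem eventually_forall_apply {P : E → Prop} {x₀ : E} (hP : ∀ᶠ x in 𝓝 x₀, P x) :
    ∀ᶠ γ : C(K, E) in 𝓝 (ContinuousMap.const K x₀), ∀ t, P (γ t) := by
  obtain ⟨ε, hε, h⟩ := Metric.eventually_nhds_iff.1 hP
  filter_upwards [Metric.ball_mem_nhds _ hε] with γ hγ t
  exact h ((ContinuousMap.dist_apply_le_dist t).trans_lt hγ)

/-- Evaluation at `t` is continuous and linear, so the chain rule gives two expressions for the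
derivative of `γ ↦ f (γ t)`, which must agree. -/
theorem eventually_fderiv_superpose_apply [CompleteSpace F] {f : E → F} {x₀ : E}
    (hf : AnalyticAt 𝕜 f x₀) :
    ∀ᶠ γ in 𝓝 (ContinuousMap.const K x₀), ∀ (η : C(K, E)) (t : K),
      fderiv 𝕜 (superpose K f) γ η t = fderiv 𝕜 f (γ t) (η t) := by
  filter_upwards [(analyticAt_superpose (K := K) hf).eventually_analyticAt,
    (eventually_superpose_apply (K := K) hf).eventually_nhds,
    eventually_forall_apply (K := K) hf.eventually_analyticAt] with γ h1 h2 h3 η t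
  have e1 : HasFDerivAt (fun γ ↦ superpose K f γ t)
      ((ContinuousMap.evalCLM 𝕜 t).comp (fderiv 𝕜 (superpose K f) γ)) γ :=
    (ContinuousMap.evalCLM 𝕜 t : C(K, F) →L[𝕜] F).hasFDerivAt.comp γ
      h1.differentiableAt.hasFDerivAt
  have e2 : HasFDerivAt (fun γ : C(K, E) ↦ f (γ t))
      ((fderiv 𝕜 f (γ t)).comp (ContinuousMap.evalCLM 𝕜 t)) γ :=
    HasFDerivAt.comp (f := fun γ : C(K, E) ↦ γ t) γ (h3 t).differentiableAt.hasFDerivAt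
      (ContinuousMap.evalCLM 𝕜 t : C(K, E) →L[𝕜] E).hasFDerivAt
  have e3 := e1.unique (e2.congr_of_eventuallyEq (h2.mono fun γ h ↦ h t))
  exact DFunLike.congr_fun e3 η

end Superposition

/-! ### Linear operators on curves -/

section Integration

theorem continuous_comp_projIcc {E : Type*} [NormedAddCommGroup E] (f : C(unitInterval, E)) :
    Continuous fun s : ℝ ↦ f (Set.projIcc 0 1 zero_le_one s) := by
  fun_prop

variable {E : Type*} [NormedAddCommGroup E] [NormedSpace ℂ E]

/-- The Volterra operator `f ↦ (t ↦ ∫ s in 0..t, f s)` on continuous curves. -/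
noncomputable def volterra (E : Type*) [NormedAddCommGroup E] [NormedSpace ℂ E] :
    C(unitInterval, E) →L[ℂ] C(unitInterval, E) :=
  LinearMap.mkContinuous
    { toFun := fun f ↦ ⟨fun t ↦ ∫ s in (0 : ℝ)..t, f (Set.projIcc 0 1 zero_le_one s),
        (intervalIntegral.continuous_primitive (fun a b ↦
          (continuous_comp_projIcc f).intervalIntegrable a b) 0).comp continuous_subtype_val⟩
      map_add' := fun f g ↦ by
        ext t
        exact intervalIntegral.integral_add ((continuous_comp_projIcc f).intervalIntegrable _ _)
          ((continuous_comp_projIcc g).intervalIntegrable _ _)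
      map_smul' := fun c f ↦ by
        ext t
        exact intervalIntegral.integral_smul c _ } 1 (by
    intro f
    rw [one_mul]
    refine (ContinuousMap.norm_le _ (norm_nonneg _)).2 fun t ↦ ?_
    refine (intervalIntegral.norm_integral_le_of_norm_le_const (C := ‖f‖)
      fun s _ ↦ f.norm_coe_le_norm _).trans ?_
    rw [sub_zero, abs_of_nonneg t.2.1]
    exact mul_le_of_le_one_right (norm_nonneg _) t.2.2)

theorem volterra_apply (f : C(unitInterval, E)) (t : unitInterval) :
    volterra E f t = ∫ s in (0 : ℝ)..t, f (Set.projIcc 0 1 zero_le_one s) := rfl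

/-- Multiplication by the parameter `t` on curves defined on the unit interval. -/
noncomputable def mulParam (E : Type*) [NormedAddCommGroup E] [NormedSpace ℂ E] :
    C(unitInterval, E) →L[ℂ] C(unitInterval, E) :=
  LinearMap.mkContinuous
    { toFun := fun f ↦ ⟨fun t ↦ ((t : ℝ) : ℂ) • f t, by fun_prop⟩
      map_add' := fun f g ↦ by ext t; simp
      map_smul' := fun c f ↦ by ext t; simp [smul_comm c] } 1 (by
    intro f
    rw [one_mul]
    refine (ContinuousMap.norm_le _ (norm_nonneg _)).2 fun t ↦ ?_
    simp only [LinearMap.coe_mk, AddHom.coe_mk, ContinuousMap.coe_mk, norm_smul,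
      Complex.norm_real, Real.norm_eq_abs, abs_of_nonneg t.2.1]
    exact (mul_le_of_le_one_left (norm_nonneg _) t.2.2).trans (f.norm_coe_le_norm t))

theorem mulParam_apply (f : C(unitInterval, E)) (t : unitInterval) :
    mulParam E f t = ((t : ℝ) : ℂ) • f t := rfl

/-- The constant curves, as a continuous linear map. -/
noncomputable def constCurve (E : Type*) [NormedAddCommGroup E] [NormedSpace ℂ E] :
    E →L[ℂ] C(unitInterval, E) :=
  LinearMap.mkContinuous
    { toFun := fun x ↦ ContinuousMap.const _ x
      map_add' := fun _ _ ↦ rfl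
      map_smul' := fun _ _ ↦ rfl } 1 (by
    intro f
    rw [one_mul]
    exact (ContinuousMap.norm_le _ (norm_nonneg _)).2 fun t ↦ le_rfl)

theorem constCurve_apply (x : E) (t : unitInterval) : constCurve E x t = x := rfl

/-- Postcomposition of curves with a continuous linear map. -/
noncomputable def mapCurve {F : Type*} [NormedAddCommGroup F] [NormedSpace ℂ F] (L : E →L[ℂ] F) :
    C(unitInterval, E) →L[ℂ] C(unitInterval, F) :=
  L.compLeftContinuous ℂ unitInterval

theorem mapCurve_apply {F : Type*} [NormedAddCommGroup F] [NormedSpace ℂ F] (L : E →L[ℂ] F)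
    (γ : C(unitInterval, E)) (t : unitInterval) : mapCurve L γ t = L (γ t) := rfl

end Integration

/-! ### The Poincaré lemma for holomorphic 2-forms -/

section Poincare

variable {E F G : Type*} [NormedAddCommGroup E] [NormedSpace ℂ E]
  [NormedAddCommGroup F] [NormedSpace ℂ F] [CompleteSpace F]
  [NormedAddCommGroup G] [NormedSpace ℂ G] [CompleteSpace G]

theorem map_volterra (L : F →L[ℂ] G) (f : C(unitInterval, F)) (t : unitInterval) :
    L (volterra F f t) = ∫ s in (0 : ℝ)..t, L (f (Set.projIcc 0 1 zero_le_one s)) := by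
  rw [volterra_apply]
  exact ((L.restrictScalars ℝ).intervalIntegral_comp_comm
    ((continuous_comp_projIcc f).intervalIntegrable _ _)).symm

/-- The operator `β ↦ (x ↦ ∫ s in 0..1, s • β (s • x))`. -/
noncomputable def radialAverage (β : E → F) (x : E) : F :=
  volterra F (mulParam F (superpose unitInterval β (mulParam E (constCurve E x)))) 1

theorem analyticAt_radialAverage {β : E → F} (hβ : AnalyticAt ℂ β 0) :
    AnalyticAt ℂ (radialAverage β) 0 := by
  let J : C(unitInterval, F) →L[ℂ] F :=
    (ContinuousMap.evalCLM ℂ 1).comp ((volterra F).comp (mulParam F))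
  have h0 : ((mulParam E).comp (constCurve E)) 0 = ContinuousMap.const unitInterval 0 := by
    rw [map_zero]; rfl
  exact (J.analyticAt _).comp (AnalyticAt.comp_of_eq (analyticAt_superpose hβ)
    (((mulParam E).comp (constCurve E)).analyticAt 0) h0)

theorem tendsto_mulParam_constCurve :
    Filter.Tendsto (fun x : E ↦ mulParam E (constCurve E x)) (𝓝 0)
      (𝓝 (ContinuousMap.const unitInterval 0)) := by
  have := ((mulParam E).comp (constCurve E)).continuous.tendsto 0
  rwa [map_zero] at this

theorem map_radialAverage {β : E → F} (hβ : AnalyticAt ℂ β 0) :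
    ∀ᶠ x in 𝓝 (0 : E), ∀ L : F →L[ℂ] G, L (radialAverage β x) =
      ∫ s in (0 : ℝ)..1, (s : ℂ) • L (β ((s : ℂ) • x)) := by
  filter_upwards [tendsto_mulParam_constCurve.eventually (eventually_superpose_apply hβ)] with x h L
  rw [radialAverage, map_volterra]
  refine intervalIntegral.integral_congr fun s hs ↦ ?_
  rw [Set.uIcc_of_le (by simp)] at hs
  simp only [mulParam_apply, h, constCurve_apply, map_smul, Set.projIcc_of_mem zero_le_one hs]

theorem map_fderiv_radialAverage {β : E → F} (hβ : AnalyticAt ℂ β 0) :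
    ∀ᶠ x in 𝓝 (0 : E), ∀ (L : F →L[ℂ] G) (u : E), L (fderiv ℂ (radialAverage β) x u) =
      ∫ s in (0 : ℝ)..1, (s : ℂ) • L (fderiv ℂ β ((s : ℂ) • x) ((s : ℂ) • u)) := by
  filter_upwards [tendsto_mulParam_constCurve.eventually (eventually_fderiv_superpose_apply hβ),
    tendsto_mulParam_constCurve.eventually (analyticAt_superpose hβ).eventually_analyticAt]
    with x h h' L u
  let J : C(unitInterval, F) →L[ℂ] F :=
    (ContinuousMap.evalCLM ℂ 1).comp ((volterra F).comp (mulParam F))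
  have e : HasFDerivAt (radialAverage β) (J.comp ((fderiv ℂ (superpose unitInterval β)
      (mulParam E (constCurve E x))).comp ((mulParam E).comp (constCurve E)))) x :=
    J.hasFDerivAt.comp x (HasFDerivAt.comp (g := superpose unitInterval β)
      (f := (mulParam E).comp (constCurve E)) x h'.differentiableAt.hasFDerivAt
      ((mulParam E).comp (constCurve E)).hasFDerivAt)
  rw [e.fderiv]
  change L (volterra F (mulParam F (fderiv ℂ (superpose unitInterval β)
      (mulParam E (constCurve E x)) (mulParam E (constCurve E u)))) 1) = _
  rw [map_volterra]
  refine intervalIntegral.integral_congr fun s hs ↦ ?_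
  rw [Set.uIcc_of_le (by simp)] at hs
  simp only [mulParam_apply, h, constCurve_apply, map_smul, Set.projIcc_of_mem zero_le_one hs]

/-- Integrated over `[0, 1]`, this derivative gives back `L (β x)`. The factor `s ^ 2` is that of a
2-form pulled back by the homothety `s`. -/
theorem hasDerivAt_sq_smul_comp_smul {E F : Type*} [NormedAddCommGroup E] [NormedSpace ℂ E]
    [NormedAddCommGroup F] [NormedSpace ℂ F] {β : E → F} {x : E} {s : ℝ}
    (hβ : DifferentiableAt ℂ β ((s : ℂ) • x)) (L : F →L[ℂ] ℂ) :
    HasDerivAt (fun s : ℝ ↦ (s : ℂ) ^ 2 * L (β ((s : ℂ) • x)))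
      (2 * (s : ℂ) * L (β ((s : ℂ) • x)) + (s : ℂ) ^ 2 * L (fderiv ℂ β ((s : ℂ) • x) x)) s := by
  have h1 : HasDerivAt (fun z : ℂ ↦ β (z • x)) (fderiv ℂ β ((s : ℂ) • x) x) s := by
    have := hβ.hasFDerivAt.comp_hasDerivAt (s : ℂ) ((hasDerivAt_id (s : ℂ)).smul_const x)
    rwa [one_smul] at this
  have h2 := L.hasFDerivAt.comp_hasDerivAt (s : ℂ) h1
  have h3 := ((hasDerivAt_id (s : ℂ)).pow 2).mul h2
  refine h3.comp_ofReal.congr_deriv ?_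
  simp

theorem continuousOn_radial {E F : Type*} [NormedAddCommGroup E] [NormedSpace ℂ E]
    [NormedAddCommGroup F] [NormedSpace ℂ F] {β : E → F} {x : E} {S : Set ℝ}
    (hβ : ∀ s ∈ S, AnalyticAt ℂ β ((s : ℂ) • x)) (L : F →L[ℂ] ℂ) :
    ContinuousOn (fun s : ℝ ↦ L (β ((s : ℂ) • x))) S := fun s hs ↦
  ((L.continuous.continuousAt.comp (hβ s hs).continuousAt).comp
    (f := fun s : ℝ ↦ (s : ℂ) • x) (by fun_prop)).continuousWithinAt

theorem continuousOn_radial_fderiv {β : E → F} {x : E} {S : Set ℝ}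
    (hβ : ∀ s ∈ S, AnalyticAt ℂ β ((s : ℂ) • x)) (L : F →L[ℂ] ℂ) {g : ℝ → E} (hg : Continuous g) :
    ContinuousOn (fun s : ℝ ↦ L (fderiv ℂ β ((s : ℂ) • x) (g s))) S := by
  refine L.continuous.comp_continuousOn (ContinuousOn.clm_apply (fun s hs ↦ ?_) hg.continuousOn)
  exact ((hβ s hs).fderiv.continuousAt.comp
    (f := fun s : ℝ ↦ (s : ℂ) • x) (by fun_prop)).continuousWithinAt

set_option synthInstance.maxHeartbeats 200000 in
/-- The Poincaré lemma for holomorphic `2`-forms near the origin. -/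
theorem exists_primitive {β : E → E →L[ℂ] E →L[ℂ] ℂ} (hβ : AnalyticAt ℂ β 0) (h0 : β 0 = 0)
    (halt : ∀ᶠ x in 𝓝 0, ∀ u v, β x u v = - β x v u)
    (hcl : ∀ᶠ x in 𝓝 0, ∀ u v w,
      fderiv ℂ β x u v w - fderiv ℂ β x v u w + fderiv ℂ β x w u v = 0) :
    ∃ α : E → E →L[ℂ] ℂ, AnalyticAt ℂ α 0 ∧ α 0 = 0 ∧ fderiv ℂ α 0 = 0 ∧
      ∀ᶠ x in 𝓝 0, ∀ u v, fderiv ℂ α x u v - fderiv ℂ α x v u = β x u v := by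
  set A := radialAverage β with hA
  have hAan : AnalyticAt ℂ A 0 := analyticAt_radialAverage hβ
  let ev (u v : E) : (E →L[ℂ] E →L[ℂ] ℂ) →L[ℂ] ℂ :=
    (ContinuousLinearMap.apply ℂ ℂ v).comp (ContinuousLinearMap.apply ℂ (E →L[ℂ] ℂ) u)
  have hA0 : A 0 = 0 := by
    ext u v
    have := (map_radialAverage hβ).self_of_nhds (ev u v)
    simpa [ev, h0] using this
  have hder : ∀ x, DifferentiableAt ℂ A x → HasFDerivAt (fun x ↦ A x x)
      ((A x) + (fderiv ℂ A x).flip x) x := by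
    intro x hx
    simpa using hx.hasFDerivAt.clm_apply (hasFDerivAt_id x)
  -- The usual radial homotopy formula `α x = ∫ s β(s x)(x, ·) ds`. Since `A 0 = 0`, the derivative
  -- of `A x x` also vanishes at `0`.
  refine ⟨fun x ↦ A x x, (hAan.contDiffAt.clm_apply contDiffAt_id).analyticAt, by simp, ?_, ?_⟩
  · rw [(hder 0 hAan.differentiableAt).fderiv, hA0]
    simp only [map_zero]
    exact add_zero _
  obtain ⟨ε, hε, hball⟩ := Metric.eventually_nhds_iff_ball.1
    (halt.and (hcl.and hβ.eventually_analyticAt))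
  filter_upwards [map_radialAverage (G := ℂ) hβ, map_fderiv_radialAverage (G := ℂ) hβ,
    hAan.eventually_analyticAt, Metric.ball_mem_nhds 0 hε] with x h1 h2 h3 h4 u v
  have hmem : ∀ s ∈ Set.Icc (0 : ℝ) 1, (s : ℂ) • x ∈ Metric.ball (0 : E) ε := by
    intro s hs
    rw [mem_ball_zero_iff] at h4 ⊢
    rw [norm_smul, Complex.norm_real, Real.norm_eq_abs, abs_of_nonneg hs.1]
    exact (mul_le_of_le_one_left (norm_nonneg _) hs.2).trans_lt h4
  have hu : Set.uIcc (0 : ℝ) 1 = Set.Icc 0 1 := Set.uIcc_of_le zero_le_one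
  have han : ∀ s ∈ Set.Icc (0 : ℝ) 1, AnalyticAt ℂ β ((s : ℂ) • x) := fun s hs ↦
    (hball _ (hmem s hs)).2.2
  have hofReal : Continuous fun s : ℝ ↦ (s : ℂ) := Complex.continuous_ofReal
  have ftc := intervalIntegral.integral_eq_sub_of_hasDerivAt (a := 0) (b := 1)
    (fun s hs ↦ hasDerivAt_sq_smul_comp_smul (x := x) (L := ev u v)
      (hball _ (hmem s (hu ▸ hs))).2.2.differentiableAt)
    (ContinuousOn.intervalIntegrable (by
      rw [hu]
      exact ContinuousOn.add (.mul (by fun_prop) (continuousOn_radial han _))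
        (.mul (by fun_prop) (continuousOn_radial_fderiv han _ continuous_const))))
  rw [(hder x h3.differentiableAt).fderiv]
  have i1 (u v : E) : IntervalIntegrable (fun s : ℝ ↦ (s : ℂ) • ev u v (β ((s : ℂ) • x)))
      MeasureTheory.volume 0 1 := ContinuousOn.intervalIntegrable (by
    rw [hu]
    exact hofReal.continuousOn.smul (continuousOn_radial han _))
  have i2 (u v w : E) : IntervalIntegrable
      (fun s : ℝ ↦ (s : ℂ) • ev v w (fderiv ℂ β ((s : ℂ) • x) ((s : ℂ) • u)))
      MeasureTheory.volume 0 1 := ContinuousOn.intervalIntegrable (by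
    rw [hu]
    exact hofReal.continuousOn.smul
      (continuousOn_radial_fderiv han _ (hofReal.smul continuous_const)))
  have e1 (u v : E) : A x u v = _ := h1 (ev u v)
  have e2 (u v w : E) : fderiv ℂ A x u v w = _ := h2 (ev v w) u
  simp only [add_apply, ContinuousLinearMap.flip_apply, e1, e2]
  rw [← intervalIntegral.integral_add (i1 _ _) (i2 _ _ _),
    ← intervalIntegral.integral_add (i1 _ _) (i2 _ _ _),
    ← intervalIntegral.integral_sub ((i1 _ _).add (i2 _ _ _)) ((i1 _ _).add (i2 _ _ _))]
  -- Under the integral, antisymmetry merges the undifferentiated terms into `2 s β(u, v)`, and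
  -- closedness turns the two derivative terms into `s ^ 2` times the derivative of `β(u, v)` along
  -- `x`: the integrand of `ftc`.
  refine Eq.trans (intervalIntegral.integral_congr fun s hs ↦ ?_) (ftc.trans (by simp [ev]))
  obtain ⟨a1, a2, -⟩ := hball _ (hmem s (hu ▸ hs))
  have a2 := a2 x u v
  have a1 := a1 v u
  simp only [ev, smul_eq_mul, ContinuousLinearMap.comp_apply, ContinuousLinearMap.apply_apply,
    map_smul, a1]
  linear_combination (-(s : ℂ) ^ 2) * a2

end Poincare

/-! ### Analytic flows by the inverse function theorem -/

section Flow

variable {E F : Type*} [NormedAddCommGroup E] [NormedSpace ℂ E] [CompleteSpace E]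
  [NormedAddCommGroup F] [NormedSpace ℂ F]

/-- Solutions of `γ = x + ∫ N γ` depend analytically on `x`, and their derivative in `x` solves
the linearised equation. -/
theorem exists_analytic_flow {N : C(unitInterval, E) → C(unitInterval, E)}
    (hN : AnalyticAt ℂ N 0) (hN0 : N 0 = 0) (hN1 : fderiv ℂ N 0 = 0) :
    ∃ Ψ : E → C(unitInterval, E), AnalyticAt ℂ Ψ 0 ∧ Ψ 0 = 0 ∧ fderiv ℂ Ψ 0 = constCurve E ∧
      ∀ᶠ x in 𝓝 0, Ψ x = constCurve E x + volterra E (N (Ψ x)) ∧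
        ∀ u, fderiv ℂ Ψ x u =
          constCurve E u + volterra E (fderiv ℂ N (Ψ x) (fderiv ℂ Ψ x u)) := by
  let T : C(unitInterval, E) → C(unitInterval, E) := fun γ ↦ γ - volterra E (N γ)
  have hT : AnalyticAt ℂ T 0 :=
    analyticAt_id.sub ((volterra E).analyticAt _ |>.comp hN)
  have hT0 : T 0 = 0 := by simp [T, hN0]
  have hTd : ∀ γ, DifferentiableAt ℂ N γ → HasFDerivAt T
      (ContinuousLinearMap.id ℂ _ - (volterra E).comp (fderiv ℂ N γ)) γ := fun γ h ↦
    (hasFDerivAt_id γ).sub ((volterra E).hasFDerivAt.comp γ h.hasFDerivAt)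
  have hT1 : HasFDerivAt T
      ((ContinuousLinearEquiv.refl ℂ C(unitInterval, E) : C(unitInterval, E) →L[ℂ] _)) 0 := by
    convert hTd 0 hN.differentiableAt using 1
    rw [hN1]
    ext; simp
  have hω : (ω : WithTop ℕ∞) ≠ 0 := by simp
  have hst := hT.contDiffAt (n := ω).hasStrictFDerivAt' hT1 hω
  have hS := (hT.contDiffAt (n := ω).to_localInverse hT1 hω).analyticAt
  -- The solution with initial point `x` is the local inverse of `T` at the constant curve `x`.
  -- Differentiating `T (S (constCurve E x)) = constCurve E x` gives the linearised equation.
  set S := hT.contDiffAt (n := ω).localInverse hT1 hω with hSdef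
  have hS0 : S 0 = 0 := by
    have := hT.contDiffAt (n := ω).localInverse_apply_image hT1 hω
    rwa [hT0] at this
  rw [hT0] at hS
  have hTS : ∀ᶠ y in 𝓝 0, T (S y) = y := by
    have := hst.eventually_right_inverse
    rwa [hT0] at this
  have hc0 : constCurve E 0 = 0 := map_zero _
  have htend : Filter.Tendsto (constCurve E) (𝓝 0) (𝓝 0) := by
    simpa using (constCurve E).continuous.tendsto 0
  have hΨ : AnalyticAt ℂ (fun x ↦ S (constCurve E x)) 0 :=
    AnalyticAt.comp_of_eq hS ((constCurve E).analyticAt 0) hc0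
  have hΨ0 : S (constCurve E 0) = 0 := by rw [hc0, hS0]
  have hev : ∀ᶠ x in 𝓝 0, S (constCurve E x) =
        constCurve E x + volterra E (N (S (constCurve E x))) ∧
        ∀ u, fderiv ℂ (fun x ↦ S (constCurve E x)) x u = constCurve E u +
          volterra E (fderiv ℂ N (S (constCurve E x))
            (fderiv ℂ (fun x ↦ S (constCurve E x)) x u)) := by
    have hN' := hΨ.continuousAt.eventually (show ∀ᶠ γ in 𝓝 (S (constCurve E 0)), AnalyticAt ℂ N γ by
        rw [hΨ0]; exact hN.eventually_analyticAt)
    filter_upwards [(htend.eventually hTS).eventually_nhds, hΨ.eventually_analyticAt, hN']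
      with x h1 h2 h3
    refine ⟨by simpa only [T, sub_eq_iff_eq_add] using h1.self_of_nhds, fun u ↦ ?_⟩
    have e1 := (hTd _ h3.differentiableAt).comp x h2.differentiableAt.hasFDerivAt
    have e2 := e1.unique ((constCurve E).hasFDerivAt.congr_of_eventuallyEq h1)
    have e3 := DFunLike.congr_fun e2 u
    exact sub_eq_iff_eq_add.1 e3
  refine ⟨fun x ↦ S (constCurve E x), hΨ, hΨ0, ?_, hev⟩
  ext1 u
  have := hev.self_of_nhds.2 u
  rw [this, hΨ0, hN1]
  simp

/-- The fundamental theorem of calculus. Curves are extended to `ℝ` by clamping, so the derivative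
is taken within `Icc 0 1`. -/
theorem hasDerivWithinAt_of_eq_volterra {f g : C(unitInterval, E)} {x : E}
    (h : f = constCurve E x + volterra E g) {t : ℝ} (ht : t ∈ Set.Icc (0 : ℝ) 1) :
    HasDerivWithinAt (fun s : ℝ ↦ f (Set.projIcc 0 1 zero_le_one s)) (g ⟨t, ht⟩)
      (Set.Icc 0 1) t := by
  have h1 := ((continuous_comp_projIcc g).integral_hasStrictDerivAt 0 t).hasDerivAt.const_add x
  rw [Set.projIcc_of_mem zero_le_one ht] at h1
  refine h1.hasDerivWithinAt.congr_of_mem (fun s hs ↦ ?_) ht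
  rw [h, Set.projIcc_of_mem zero_le_one hs]
  rfl

theorem HasDerivWithinAt.complex_clm_apply {E F : Type*} [NormedAddCommGroup E] [NormedSpace ℂ E]
    [NormedAddCommGroup F] [NormedSpace ℂ F] {M : ℝ → E →L[ℂ] F}
    {v : ℝ → E} {M' : E →L[ℂ] F} {v' : E} {s : Set ℝ} {t : ℝ} (hM : HasDerivWithinAt M M' s t)
    (hv : HasDerivWithinAt v v' s t) :
    HasDerivWithinAt (fun t ↦ M t (v t)) (M' (v t) + M t v') s t := by
  have := ((isBoundedBilinearMap_apply (𝕜 := ℂ) (E := E) (F := F)).hasFDerivAt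
    (M t, v t)).restrictScalars ℝ |>.comp_hasDerivWithinAt t (hM.prodMk hv)
  refine this.congr_deriv ?_
  simp [add_comm]

theorem HasFDerivAt.comp_hasDerivWithinAt_real {E F : Type*} [NormedAddCommGroup E]
    [NormedSpace ℂ E] [NormedAddCommGroup F] [NormedSpace ℂ F] {f : E → F} {f' : E →L[ℂ] F}
    {c : ℝ → E} {c' : E} {s : Set ℝ} {t : ℝ} (hf : HasFDerivAt f f' (c t))
    (hc : HasDerivWithinAt c c' s t) : HasDerivWithinAt (fun t ↦ f (c t)) (f' c') s t :=
  (hf.restrictScalars ℝ).comp_hasDerivWithinAt t hc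

theorem DifferentiableAt.hasDerivWithinAt_comp_clm_apply {E F G : Type*} [NormedAddCommGroup E]
    [NormedSpace ℂ E] [NormedAddCommGroup F] [NormedSpace ℂ F] [NormedAddCommGroup G]
    [NormedSpace ℂ G] {β : E → F →L[ℂ] G} {c : ℝ → E} {c' : E} {η : ℝ → F} {η' : F} {s : Set ℝ}
    {t : ℝ} (hβ : DifferentiableAt ℂ β (c t)) (hc : HasDerivWithinAt c c' s t)
    (hη : HasDerivWithinAt η η' s t) :
    HasDerivWithinAt (fun s ↦ β (c s) (η s)) (fderiv ℂ β (c t) c' (η t) + β (c t) η') s t :=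
  (hβ.hasFDerivAt.comp_hasDerivWithinAt_real hc).complex_clm_apply hη

end Flow

/-! ### Solving the Moser equation -/

section Moser

variable {E F : Type*} [NormedAddCommGroup E] [NormedSpace ℂ E] [NormedAddCommGroup F]
  [NormedSpace ℂ F]

/-- The solution `X` of `(B₀ + p.1) X = - p.2`. -/
noncomputable def moserSolve (B₀ : E ≃L[ℂ] F)
    (p : (E →L[ℂ] F) × F) : E :=
  -(ContinuousLinearMap.inverse ((B₀ : E →L[ℂ] F) + p.1)) p.2

theorem moserSolve_zero (B₀ : E ≃L[ℂ] F) : moserSolve B₀ 0 = 0 := by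
  simp [moserSolve]

variable [CompleteSpace E]

theorem analyticAt_moserSolve (B₀ : E ≃L[ℂ] F) : AnalyticAt ℂ (moserSolve B₀) 0 := by
  have h1 : ContDiffAt ℂ ω (fun p : (E →L[ℂ] F) × F ↦
      ContinuousLinearMap.inverse ((B₀ : E →L[ℂ] F) + p.1)) 0 := by
    refine ContDiffAt.comp (g := ContinuousLinearMap.inverse) _ ?_
      (contDiffAt_const.add contDiffAt_fst)
    simpa using contDiffAt_map_inverse B₀
  exact (h1.clm_apply contDiffAt_snd).neg.analyticAt

/-- Invertible operators form an open set, so near `p = 0` the map `inverse` is a genuine inverse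
and not its default value `0`. -/
theorem eventually_moserSolve (B₀ : E ≃L[ℂ] F) :
    ∀ᶠ p in 𝓝 0, B₀ (moserSolve B₀ p) + p.1 (moserSolve B₀ p) = - p.2 := by
  have hev : ∀ᶠ M in 𝓝 (B₀ : E →L[ℂ] F), ∃ e : E ≃L[ℂ] F, (e : E →L[ℂ] F) = M :=
    ContinuousLinearEquiv.nhds B₀
  have ht : Filter.Tendsto (fun p : (E →L[ℂ] F) × F ↦
      (B₀ : E →L[ℂ] F) + p.1) (𝓝 0) (𝓝 (B₀ : E →L[ℂ] F)) := by
    have : Continuous (fun p : (E →L[ℂ] F) × F ↦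
      (B₀ : E →L[ℂ] F) + p.1) := by fun_prop
    simpa using this.tendsto 0
  filter_upwards [ht.eventually hev] with p ⟨e, he⟩
  have : B₀ (moserSolve B₀ p) + p.1 (moserSolve B₀ p) = e (moserSolve B₀ p) := by
    rw [← ContinuousLinearEquiv.coe_coe e, he]; rfl
  rw [this, moserSolve, ← he, ContinuousLinearMap.inverse_equiv]
  simp

end Moser

/-! ### The Moser vector field and its operator on curves -/

section MoserFlow

variable {E F : Type*} [NormedAddCommGroup E] [NormedSpace ℂ E] 
  [NormedAddCommGroup F] [NormedSpace ℂ F]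

/-- The solution `X` of `(B₀ + s β) X = - α`, as a vector field depending on `s`. -/
noncomputable def moserField (B₀ : E ≃L[ℂ] F) (β : E → E →L[ℂ] F) (α : E → F) (s : ℂ) (x : E) : E :=
  moserSolve B₀ (s • β x, α x)

/-- One neighbourhood serves all times because `‖t • β x‖ ≤ ‖β x‖` on the unit interval. -/
theorem eventually_forall_smul {β : E → E →L[ℂ] F} {α : E → F} (hβ : ContinuousAt β 0)
    (hα : ContinuousAt α 0) (hβ0 : β 0 = 0) (hα0 : α 0 = 0) {P : (E →L[ℂ] F) × F → Prop}
    (hP : ∀ᶠ p in 𝓝 0, P p) :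
    ∀ᶠ x in 𝓝 (0 : E), ∀ t : unitInterval, P (((t : ℝ) : ℂ) • β x, α x) := by
  obtain ⟨δ, hδ, h⟩ := Metric.eventually_nhds_iff_ball.1 hP
  rw [ContinuousAt, hβ0] at hβ
  rw [ContinuousAt, hα0] at hα
  filter_upwards [hβ (Metric.ball_mem_nhds 0 hδ), hα (Metric.ball_mem_nhds 0 hδ)] with x h1 h2 t
  rw [Set.mem_preimage, mem_ball_zero_iff] at h1 h2
  refine h _ ?_
  rw [mem_ball_zero_iff, Prod.norm_mk, max_lt_iff]
  refine ⟨?_, h2⟩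
  rw [norm_smul, Complex.norm_real, Real.norm_eq_abs, abs_of_nonneg t.2.1]
  exact (mul_le_of_le_one_left (norm_nonneg _) t.2.2).trans_lt h1

variable {B₀ : E ≃L[ℂ] F} {β : E → E →L[ℂ] F} {α : E → F}

theorem moserField_zero (B₀ : E ≃L[ℂ] F) (hβ0 : β 0 = 0) (hα0 : α 0 = 0) (s : ℂ) :
    moserField B₀ β α s 0 = 0 := by
  rw [moserField, hβ0, hα0, smul_zero]
  exact moserSolve_zero B₀

/-- The operator `γ ↦ (t ↦ X t (γ t))` on curves near `0`, for `X = moserField B₀ β α`. -/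
noncomputable def moserOperator (B₀ : E ≃L[ℂ] F) (β : E → E →L[ℂ] F) (α : E → F)
    (γ : C(unitInterval, E)) : C(unitInterval, E) :=
  superpose unitInterval (moserSolve B₀)
    ((mapCurve (ContinuousLinearMap.inl ℂ (E →L[ℂ] F) F))
      (mulParam _ (superpose unitInterval β γ)) +
    (mapCurve (ContinuousLinearMap.inr ℂ (E →L[ℂ] F) F))
      (superpose unitInterval α γ))

theorem superpose_zero {K E F : Type*} [TopologicalSpace K] [TopologicalSpace E] [Zero E]
    [TopologicalSpace F] [Zero F] {f : E → F} (hf : f 0 = 0) :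
    superpose K f (0 : C(K, E)) = 0 := by
  have h : f ∘ (0 : C(K, E)) = fun _ ↦ 0 := funext fun _ ↦ hf
  ext t
  rw [superpose_apply (h ▸ continuous_const)]
  exact hf

theorem moserOperator_zero (B₀ : E ≃L[ℂ] F) (hβ0 : β 0 = 0) (hα0 : α 0 = 0) :
    moserOperator B₀ β α 0 = 0 := by
  rw [moserOperator, superpose_zero hβ0, superpose_zero hα0, map_zero, map_zero, map_zero,
    add_zero, superpose_zero (moserSolve_zero B₀)]

variable [CompleteSpace E]

theorem eventually_analyticAt_moserField [CompleteSpace F] (B₀ : E ≃L[ℂ] F) (hβ : AnalyticAt ℂ β 0)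
    (hα : AnalyticAt ℂ α 0) (hβ0 : β 0 = 0) (hα0 : α 0 = 0) :
    ∀ᶠ x in 𝓝 (0 : E), ∀ t : unitInterval, AnalyticAt ℂ (moserField B₀ β α (t : ℝ)) x := by
  filter_upwards [hβ.eventually_analyticAt, hα.eventually_analyticAt,
    eventually_forall_smul hβ.continuousAt hα.continuousAt hβ0 hα0
      (analyticAt_moserSolve B₀).eventually_analyticAt] with x h1 h2 h3 t
  exact AnalyticAt.comp (g := moserSolve B₀) (f := fun x ↦ (((t : ℝ) : ℂ) • β x, α x)) (h3 t)
    (AnalyticAt.prod (AnalyticAt.fun_const_smul h1) h2)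

theorem eventually_moserField (B₀ : E ≃L[ℂ] F) (hβ : AnalyticAt ℂ β 0)
    (hα : AnalyticAt ℂ α 0) (hβ0 : β 0 = 0) (hα0 : α 0 = 0) :
    ∀ᶠ x in 𝓝 (0 : E), ∀ t : unitInterval, B₀ (moserField B₀ β α (t : ℝ) x) +
      ((t : ℝ) : ℂ) • β x (moserField B₀ β α (t : ℝ) x) = - α x :=
  eventually_forall_smul hβ.continuousAt hα.continuousAt hβ0 hα0 (eventually_moserSolve B₀)

/-- Implicit differentiation of `(B₀ + t β) X = -α` in the space variable. -/
theorem eventually_fderiv_moserField [CompleteSpace F] (B₀ : E ≃L[ℂ] F) (hβ : AnalyticAt ℂ β 0)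
    (hα : AnalyticAt ℂ α 0) (hβ0 : β 0 = 0) (hα0 : α 0 = 0) :
    ∀ᶠ x in 𝓝 (0 : E), ∀ (t : unitInterval) (u : E),
      B₀ (fderiv ℂ (moserField B₀ β α (t : ℝ)) x u) +
      ((t : ℝ) : ℂ) • (β x (fderiv ℂ (moserField B₀ β α (t : ℝ)) x u) +
        fderiv ℂ β x u (moserField B₀ β α (t : ℝ) x)) = - fderiv ℂ α x u := by
  filter_upwards [eventually_analyticAt_moserField B₀ hβ hα hβ0 hα0,
    (eventually_moserField B₀ hβ hα hβ0 hα0).eventually_nhds,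
    hβ.eventually_analyticAt, hα.eventually_analyticAt] with x h1 h2 h3 h4 t u
  have d1 := (h1 t).differentiableAt.hasFDerivAt
  have d2 := (((B₀ : E →L[ℂ] F).hasFDerivAt.comp x d1).add
    ((h3.differentiableAt.hasFDerivAt.clm_apply d1).const_smul ((t : ℝ) : ℂ))).unique
    (h4.differentiableAt.hasFDerivAt.neg.congr_of_eventuallyEq (h2.mono fun x h ↦ h t))
  exact DFunLike.congr_fun d2 u

/-- Time enters only through the linear operator `mulParam`, so superposition with time-independent
functions suffices. -/
theorem analyticAt_moserOperator [CompleteSpace F] (B₀ : E ≃L[ℂ] F) (hβ : AnalyticAt ℂ β 0)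
    (hα : AnalyticAt ℂ α 0) (hβ0 : β 0 = 0) (hα0 : α 0 = 0) :
    AnalyticAt ℂ (moserOperator B₀ β α) 0 := by
  refine AnalyticAt.comp_of_eq (analyticAt_superpose (analyticAt_moserSolve B₀))
    (f := fun γ ↦ (mapCurve (ContinuousLinearMap.inl ℂ (E →L[ℂ] F) F))
      (mulParam _ (superpose unitInterval β γ)) +
    (mapCurve (ContinuousLinearMap.inr ℂ (E →L[ℂ] F) F))
      (superpose unitInterval α γ)) (AnalyticAt.add ?_ ?_) ?_
  · exact ((mapCurve (ContinuousLinearMap.inl ℂ (E →L[ℂ] F) F)).comp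
      (mulParam (E →L[ℂ] F))).analyticAt _ |>.comp (analyticAt_superpose hβ)
  · exact (mapCurve (ContinuousLinearMap.inr ℂ (E →L[ℂ] F) F)).analyticAt _
      |>.comp (analyticAt_superpose hα)
  · rw [superpose_zero hβ0, superpose_zero hα0, map_zero, map_zero, map_zero, add_zero]
    rfl

theorem eventually_moserOperator_apply (B₀ : E ≃L[ℂ] F) (hβ : AnalyticAt ℂ β 0)
    (hα : AnalyticAt ℂ α 0) (hβ0 : β 0 = 0) (hα0 : α 0 = 0) :
    ∀ᶠ γ in 𝓝 0, ∀ t, moserOperator B₀ β α γ t = moserField B₀ β α (t : ℝ) (γ t) := by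
  have hβe := eventually_superpose_apply (K := unitInterval) hβ
  have hαe := eventually_superpose_apply (K := unitInterval) hα
  have hc : ∀ᶠ γ : C(unitInterval, E) in 𝓝 0, ∀ s t : unitInterval,
      AnalyticAt ℂ (moserSolve B₀) (((t : ℝ) : ℂ) • β (γ s), α (γ s)) :=
    eventually_forall_apply (eventually_forall_smul hβ.continuousAt hα.continuousAt hβ0 hα0
      (analyticAt_moserSolve B₀).eventually_analyticAt)
  filter_upwards [hβe, hαe, hc] with γ h1 h2 h3 t
  have hval : ∀ t, ((mapCurve (ContinuousLinearMap.inl ℂ (E →L[ℂ] F) F))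
      (mulParam _ (superpose unitInterval β γ)) +
    (mapCurve (ContinuousLinearMap.inr ℂ (E →L[ℂ] F) F))
      (superpose unitInterval α γ)) t = (((t : ℝ) : ℂ) • β (γ t), α (γ t)) := by
    intro t
    simp [mapCurve_apply, mulParam_apply, h1, h2]
  rw [moserOperator, superpose_apply, hval, moserField]
  -- Continuity of the composite rules out the default value `0` of the outer `superpose`.
  rw [continuous_iff_continuousAt]
  intro t
  refine ContinuousAt.comp (g := moserSolve B₀) ?_ (ContinuousMap.continuousAt _ _)
  rw [hval]
  exact (h3 t t).continuousAt

theorem eventually_fderiv_moserOperator_apply [CompleteSpace F] (B₀ : E ≃L[ℂ] F)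
    (hβ : AnalyticAt ℂ β 0)
    (hα : AnalyticAt ℂ α 0) (hβ0 : β 0 = 0) (hα0 : α 0 = 0) :
    ∀ᶠ γ in 𝓝 0, ∀ η t, fderiv ℂ (moserOperator B₀ β α) γ η t =
      fderiv ℂ (moserField B₀ β α (t : ℝ)) (γ t) (η t) := by
  have h3 : ∀ᶠ γ : C(unitInterval, E) in 𝓝 0, ∀ s t : unitInterval,
      AnalyticAt ℂ (moserField B₀ β α (t : ℝ)) (γ s) :=
    eventually_forall_apply (eventually_analyticAt_moserField B₀ hβ hα hβ0 hα0)
  filter_upwards [(analyticAt_moserOperator B₀ hβ hα hβ0 hα0).eventually_analyticAt,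
    (eventually_moserOperator_apply B₀ hβ hα hβ0 hα0).eventually_nhds, h3] with γ h1 h2 h3 η t
  have e1 : HasFDerivAt (fun γ ↦ moserOperator B₀ β α γ t)
      ((ContinuousMap.evalCLM ℂ t).comp (fderiv ℂ (moserOperator B₀ β α) γ)) γ :=
    (ContinuousMap.evalCLM ℂ t : C(unitInterval, E) →L[ℂ] E).hasFDerivAt.comp γ
      h1.differentiableAt.hasFDerivAt
  have e2 : HasFDerivAt (fun γ : C(unitInterval, E) ↦ moserField B₀ β α (t : ℝ) (γ t))
      ((fderiv ℂ (moserField B₀ β α (t : ℝ)) (γ t)).comp (ContinuousMap.evalCLM ℂ t)) γ :=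
    HasFDerivAt.comp (f := fun γ : C(unitInterval, E) ↦ γ t) γ (h3 t t).differentiableAt.hasFDerivAt
      (ContinuousMap.evalCLM ℂ t : C(unitInterval, E) →L[ℂ] E).hasFDerivAt
  have e3 := e1.unique (e2.congr_of_eventuallyEq (h2.mono fun γ h ↦ h t))
  exact DFunLike.congr_fun e3 η

/-- At the origin the differentiated Moser equation reduces to `B₀ (dX u) = -dα u = 0`, and `B₀` is
injective. -/
theorem fderiv_moserOperator_zero [CompleteSpace F] (B₀ : E ≃L[ℂ] F) (hβ : AnalyticAt ℂ β 0)
    (hα : AnalyticAt ℂ α 0) (hβ0 : β 0 = 0) (hα0 : α 0 = 0) (hα1 : fderiv ℂ α 0 = 0) :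
    fderiv ℂ (moserOperator B₀ β α) 0 = 0 := by
  ext η t
  have h1 := (eventually_fderiv_moserOperator_apply B₀ hβ hα hβ0 hα0).self_of_nhds η t
  have h2 := (eventually_fderiv_moserField B₀ hβ hα hβ0 hα0).self_of_nhds t (η t)
  rw [hα1, hβ0, moserField_zero B₀ hβ0 hα0] at h2
  simp only [zero_apply, map_zero, add_zero, smul_zero, neg_zero,
    EmbeddingLike.map_eq_zero_iff] at h2
  rw [h1]
  exact h2

end MoserFlow

/-! ### Moser's theorem -/

section MoserTheorem

variable {E : Type*} [NormedAddCommGroup E] [NormedSpace ℂ E]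

/-- The pullback of the form `B₀ + t β` along the Moser flow does not depend on `t`. -/
theorem moser_invariant [CompleteSpace E] {B₀ : E →L[ℂ] E →L[ℂ] ℂ} {β : E → E →L[ℂ] E →L[ℂ] ℂ}
    {c η ξ V V₁ V₂ : C(unitInterval, E)} {x u v : E}
    (hc : c = constCurve E x + volterra E V) (hη : η = constCurve E u + volterra E V₁)
    (hξ : ξ = constCurve E v + volterra E V₂) (hβ : ∀ t, DifferentiableAt ℂ β (c t))
    (h : ∀ t : unitInterval, β (c t) (η t) (ξ t) + B₀ (V₁ t) (ξ t) + B₀ (η t) (V₂ t) +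
      ((t : ℝ) : ℂ) * (fderiv ℂ β (c t) (V t) (η t) (ξ t) + β (c t) (V₁ t) (ξ t) +
        β (c t) (η t) (V₂ t)) = 0) :
    B₀ (η 1) (ξ 1) + β (c 1) (η 1) (ξ 1) = B₀ u v := by
  let p : ℝ → unitInterval := Set.projIcc 0 1 zero_le_one
  -- Here `c` is a flow line and `η`, `ξ` are the images of `u`, `v` under the derivative of the
  -- flow. The product rule gives exactly the left side of `h`.
  have key : ∀ t : ℝ, ∀ ht : t ∈ Set.Icc (0 : ℝ) 1,
      HasDerivWithinAt (fun s : ℝ ↦ B₀ (η (p s)) (ξ (p s)) +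
        (s : ℂ) * β (c (p s)) (η (p s)) (ξ (p s))) 0 (Set.Icc 0 1) t := by
    intro t ht
    have dc := hasDerivWithinAt_of_eq_volterra hc ht
    have dη := hasDerivWithinAt_of_eq_volterra hη ht
    have dξ := hasDerivWithinAt_of_eq_volterra hξ ht
    have hp : p t = ⟨t, ht⟩ := Set.projIcc_of_mem zero_le_one ht
    have d1 := (B₀.hasFDerivAt.comp_hasDerivWithinAt_real dη).complex_clm_apply dξ
    have d2 := ((hβ (p t)).hasDerivWithinAt_comp_clm_apply dc dη).complex_clm_apply dξ
    have d3 : HasDerivWithinAt (fun s : ℝ ↦ (s : ℂ)) 1 (Set.Icc 0 1) t :=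
      Complex.ofRealCLM.hasDerivAt.hasDerivWithinAt
    refine (d1.add (d3.mul d2)).congr_deriv ?_
    have := h ⟨t, ht⟩
    change _ = _ at hp
    simp only [p] at hp
    simp only [hp, add_apply]
    linear_combination this
  have hconst := constant_of_derivWithin_zero (fun t ht ↦ (key t ht).differentiableWithinAt)
    (fun t ht ↦ (key t (Set.Ico_subset_Icc_self ht)).derivWithin
      (uniqueDiffOn_Icc zero_lt_one t (Set.Ico_subset_Icc_self ht))) 1
    (Set.right_mem_Icc.2 zero_le_one)
  have hp1 : p 1 = 1 := Set.projIcc_right zero_le_one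
  have hp0 : p 0 = 0 := Set.projIcc_left zero_le_one
  have h0 : ∀ {f g : C(unitInterval, E)} {x : E}, f = constCurve E x + volterra E g → f 0 = x := by
    intro f g x hf
    rw [hf, ContinuousMap.add_apply, volterra_apply, constCurve_apply]
    simp
  simpa [hp1, hp0, h0 hη, h0 hξ] using hconst

/-- The pointwise identity behind the Moser trick: `L_X (B₀ + t β) + β = 0`. -/
theorem moser_identity {B₀ b : E →L[ℂ] E →L[ℂ] ℂ} {db : E →L[ℂ] E →L[ℂ] E →L[ℂ] ℂ}
    {da : E →L[ℂ] E →L[ℂ] ℂ} {dX : E → E} {X : E} {t : ℂ}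
    (halt₀ : ∀ u v, B₀ u v = - B₀ v u) (halt : ∀ u v, b u v = - b v u)
    (hcl : ∀ u v w, db u v w - db v u w + db w u v = 0)
    (hda : ∀ u v, da u v - da v u = b u v)
    (hX : ∀ u, B₀ (dX u) + t • (b (dX u) + db u X) = - da u) (u v : E) :
    b u v + B₀ (dX u) v + B₀ u (dX v) + t * (db X u v + b (dX u) v + b u (dX v)) = 0 := by
  have e1 := DFunLike.congr_fun (hX u) v
  have e2 := DFunLike.congr_fun (hX v) u
  simp only [add_apply, smul_apply, neg_apply, smul_eq_mul] at e1 e2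
  rw [halt₀ u, halt u (dX v)]
  linear_combination e1 - e2 - hda u v + t * hcl X u v

/-- Near a point where it is non-degenerate, a closed holomorphic `2`-form is the pullback of its
value at the point under a local biholomorphism tangent to the identity. -/
theorem exists_analytic_pullback_eq [CompleteSpace E] {B : E → E →L[ℂ] E →L[ℂ] ℂ}
    (hB : AnalyticAt ℂ B 0)
    (B₀ : E ≃L[ℂ] (E →L[ℂ] ℂ)) (hB₀ : B 0 = B₀)
    (halt : ∀ᶠ x in 𝓝 0, ∀ u v, B x u v = - B x v u)
    (hcl : ∀ᶠ x in 𝓝 0, ∀ u v w,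
      fderiv ℂ B x u v w - fderiv ℂ B x v u w + fderiv ℂ B x w u v = 0) :
    ∃ φ : E → E, AnalyticAt ℂ φ 0 ∧ φ 0 = 0 ∧ fderiv ℂ φ 0 = ContinuousLinearMap.id ℂ E ∧
      ∀ᶠ x in 𝓝 0, ∀ u v, B (φ x) (fderiv ℂ φ x u) (fderiv ℂ φ x v) = B 0 u v := by
  set β : E → E →L[ℂ] E →L[ℂ] ℂ := fun x ↦ B x - B 0 with hβdef
  have hβ : AnalyticAt ℂ β 0 := hB.sub analyticAt_const
  have hβ0 : β 0 = 0 := sub_self (B 0)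
  have hfd : ∀ x, fderiv ℂ β x = fderiv ℂ B x := fun x ↦
    fderiv_sub_const (𝕜 := ℂ) (E := E) (F := E →L[ℂ] E →L[ℂ] ℂ) (f := B) (x := x) (B 0)
  have haltβ : ∀ᶠ x in 𝓝 0, ∀ u v, β x u v = - β x v u := by
    filter_upwards [halt] with x h u v
    have h0 := halt.self_of_nhds u v
    simp only [hβdef, sub_apply, h u v, h0]
    ring
  have hclβ : ∀ᶠ x in 𝓝 0, ∀ u v w,
      fderiv ℂ β x u v w - fderiv ℂ β x v u w + fderiv ℂ β x w u v = 0 := by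
    simpa only [hfd] using hcl
  obtain ⟨α, hα, hα0, hα1, hdα⟩ := exists_primitive hβ hβ0 haltβ hclβ
  obtain ⟨Ψ, hΨ, hΨ0, hΨ1, hflow⟩ := exists_analytic_flow
    (analyticAt_moserOperator B₀ hβ hα hβ0 hα0) (moserOperator_zero B₀ hβ0 hα0)
    (fderiv_moserOperator_zero B₀ hβ hα hβ0 hα0 hα1)
  have hev1 : ∀ᶠ γ : C(unitInterval, E) in 𝓝 0, ∀ t, _ :=
    eventually_forall_apply (haltβ.and (hclβ.and (hdα.and (hβ.eventually_analyticAt.and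
      (eventually_fderiv_moserField B₀ hβ hα hβ0 hα0)))))
  have htend : Filter.Tendsto Ψ (𝓝 0) (𝓝 0) := by
    simpa [hΨ0] using hΨ.continuousAt.tendsto
  let ev : C(unitInterval, E) →L[ℂ] E := ContinuousMap.evalCLM ℂ 1
  have hd : ∀ x, DifferentiableAt ℂ Ψ x →
      fderiv ℂ (fun x ↦ Ψ x 1) x = ev.comp (fderiv ℂ Ψ x) := fun x h ↦
    (ev.hasFDerivAt.comp x h.hasFDerivAt).fderiv
  refine ⟨fun x ↦ Ψ x 1, (ev.analyticAt _).comp hΨ, by simp [hΨ0], ?_, ?_⟩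
  · rw [hd 0 hΨ.differentiableAt, hΨ1]
    ext u
    rfl
  filter_upwards [hflow, htend.eventually hev1, hΨ.eventually_analyticAt,
    htend.eventually (eventually_moserOperator_apply B₀ hβ hα hβ0 hα0),
    htend.eventually (eventually_fderiv_moserOperator_apply B₀ hβ hα hβ0 hα0)]
    with x ⟨h1, h2⟩ h3 h4 h5 h6 u v
  rw [hd x h4.differentiableAt]
  have := moser_invariant (B₀ := B 0) (β := β) h1 (h2 u) (h2 v)
    (fun t ↦ (h3 t).2.2.2.1.differentiableAt) (fun t ↦ by
      obtain ⟨a1, a2, a3, -, a4⟩ := h3 t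
      rw [h5, h6, h6]
      exact moser_identity (dX := fderiv ℂ (moserField B₀ β α (t : ℝ)) (Ψ x t))
        halt.self_of_nhds a1 a2 a3 (fun u ↦ by rw [hB₀]; exact a4 t u) _ _)
  rw [← this]
  simp [hβdef, ev]

end MoserTheorem

/-! ### Linear symplectic coordinates -/

section LinearAlgebra

/-- An alternating bilinear form on a space of dimension at most `2 n` is a sum of `n` wedge
products of linear forms. -/
theorem exists_sum_wedge {𝕜 : Type*} [Field 𝕜] (n : ℕ) : ∀ {V : Type*} [AddCommGroup V]
    [Module 𝕜 V] [FiniteDimensional 𝕜 V] (_ : Module.finrank 𝕜 V ≤ 2 * n) (b : V →ₗ[𝕜] V →ₗ[𝕜] 𝕜)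
    (_ : ∀ x y, b x y = - b y x) (_ : ∀ x, b x x = 0),
    ∃ p q : Fin n → V →ₗ[𝕜] 𝕜, ∀ x y, b x y = ∑ j, (p j x * q j y - p j y * q j x) := by
  induction n with
  | zero =>
    intro V _ _ _ hV b _ _
    have : Subsingleton V := (Module.finrank_zero_iff (R := 𝕜)).1 (by omega)
    refine ⟨0, 0, fun x y ↦ ?_⟩
    simp [Subsingleton.elim x 0]
  | succ n ih =>
    intro V _ _ _ hV b halt hself
    by_cases hb : ∃ v w, b v w ≠ 0
    swap
    · push Not at hb
      exact ⟨0, 0, fun x y ↦ by simp [hb]⟩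
    obtain ⟨v, w', hvw'⟩ := hb
    obtain ⟨w, hvw⟩ : ∃ w, b v w = 1 := ⟨(b v w')⁻¹ • w', by simp [hvw']⟩
    have hwv : b w v = -1 := by rw [halt, hvw]
    let p₀ : V →ₗ[𝕜] 𝕜 := b.flip w
    let q₀ : V →ₗ[𝕜] 𝕜 := - b.flip v
    have hp₀ (x) : p₀ x = b x w := rfl
    have hq₀ (x) : q₀ x = - b x v := rfl
    -- `W` is the `b`-orthogonal complement of the hyperbolic plane spanned by `v` and `w`. It has
    -- codimension two, and `π₀` below projects onto it along that plane.
    let W : Submodule 𝕜 V := LinearMap.ker (p₀.prod q₀)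
    have hsurj : Function.Surjective (p₀.prod q₀) := by
      rintro ⟨s, t⟩
      refine ⟨s • v + t • w, ?_⟩
      simp [hp₀, hq₀, hvw, hwv, hself]
    have hW : Module.finrank 𝕜 W ≤ 2 * n := by
      have h1 := LinearMap.finrank_range_add_finrank_ker (p₀.prod q₀)
      rw [LinearMap.range_eq_top.2 hsurj, finrank_top, Module.finrank_prod,
        Module.finrank_self] at h1
      change 1 + 1 + Module.finrank 𝕜 W = _ at h1
      omega
    let π₀ : V →ₗ[𝕜] V := LinearMap.id - p₀.smulRight v - q₀.smulRight w
    have hπ₀ (x) : π₀ x = x - p₀ x • v - q₀ x • w := rfl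
    let π : V →ₗ[𝕜] W := π₀.codRestrict W fun x ↦ by
      simp [W, hπ₀, hp₀, hq₀, hvw, hwv, hself]
    obtain ⟨p, q, hpq⟩ := ih hW ((b.domRestrict₁₂ W W)) (fun x y ↦ halt x y) (fun x ↦ hself x)
    refine ⟨Fin.cons p₀ fun j ↦ (p j).comp π, Fin.cons q₀ fun j ↦ (q j).comp π, fun x y ↦ ?_⟩
    have h1 : b (π₀ x) (π₀ y) = _ := hpq (π x) (π y)
    rw [Fin.sum_univ_succ]
    simp only [Fin.cons_zero, Fin.cons_succ, LinearMap.comp_apply]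
    rw [← h1, hπ₀, hπ₀]
    simp only [map_sub, map_smul, LinearMap.sub_apply, LinearMap.smul_apply, hp₀, hq₀, smul_eq_mul,
      hself, hvw, hwv, halt v y, halt w y]
    ring

/-- The standard symplectic form `∑ dP_j ∧ dQ_j` on `ℂ ^ (2 n)`. -/
def stdForm {n : ℕ} (u v : CSpace (2 * n)) : ℂ :=
  ∑ j : Fin n, (coordP id j u * coordQ id j v - coordP id j v * coordQ id j u)

theorem exists_symplectic_coordinates {n : ℕ}
    (b : CSpace (2 * n) →L[ℂ] CSpace (2 * n) →L[ℂ] ℂ) (halt : ∀ x y, b x y = - b y x)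
    (hnd : ∀ x, x ≠ 0 → ∃ y, b x y ≠ 0) :
    ∃ e : CSpace (2 * n) ≃L[ℂ] CSpace (2 * n), ∀ x y, b x y = stdForm (e x) (e y) := by
  let b' : CSpace (2 * n) →ₗ[ℂ] CSpace (2 * n) →ₗ[ℂ] ℂ :=
    LinearMap.mk₂ ℂ (fun x y ↦ b x y) (by simp) (by simp) (by simp) (by simp)
  obtain ⟨p, q, hpq⟩ := exists_sum_wedge n (by simp) b' halt
    (fun x ↦ self_eq_neg.1 (halt x x))
  let f : CSpace (2 * n) →ₗ[ℂ] CSpace (2 * n) :=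
    (WithLp.linearEquiv 2 ℂ (Fin (2 * n) → ℂ)).symm.toLinearMap.comp
      (LinearMap.pi fun i ↦ if h : (i : ℕ) < n then q ⟨i, h⟩ else p ⟨i - n, by omega⟩)
  have hQ (x) (j : Fin n) : coordQ id j (f x) = q j x := by
    simp [coordQ, f]
  have hP (x) (j : Fin n) : coordP id j (f x) = p j x := by
    simp [coordP, f]
  have hstd (x y) : b x y = stdForm (f x) (f y) := by
    simp only [stdForm, hQ, hP]
    exact hpq x y
  -- The kernel of `f` lies in the radical of `b`, which is zero.
  have hinj : Function.Injective f := by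
    rw [← LinearMap.ker_eq_bot, LinearMap.ker_eq_bot']
    intro x hx
    by_contra h
    obtain ⟨y, hy⟩ := hnd x h
    refine hy ?_
    rw [hstd, hx]
    simp [stdForm, coordP, coordQ]
  exact ⟨(LinearEquiv.ofInjectiveEndo f hinj).toContinuousLinearEquiv, hstd⟩

end LinearAlgebra

/-! ### From alternating forms to bilinear maps; Darboux on open sets -/

section Forms

variable {E : Type*} [NormedAddCommGroup E] [NormedSpace ℂ E]

/-- An alternating `2`-form, seen as a bilinear map. -/
noncomputable def formToBilin (E : Type*) [NormedAddCommGroup E] [NormedSpace ℂ E] :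
    (E [⋀^Fin 2]→L[ℂ] ℂ) →L[ℂ] (E →L[ℂ] E →L[ℂ] ℂ) :=
  (ContinuousLinearMap.compL ℂ E (E [⋀^Fin 1]→L[ℂ] ℂ) (E →L[ℂ] ℂ)
    (ContinuousAlternatingMap.ofSubsingletonLIE (𝕜 := ℂ) (E := E) (F := ℂ)
      (0 : Fin 1)).symm.toContinuousLinearEquiv.toContinuousLinearMap).comp
    (ContinuousAlternatingMap.curryLeftLI (𝕜 := ℂ) (E := E) (F := ℂ) (n := 1)).toContinuousLinearMap

theorem formToBilin_apply (A : E [⋀^Fin 2]→L[ℂ] ℂ) (u v : E) :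
    formToBilin E A u v = A ![u, v] := by
  change A (Matrix.vecCons u fun _ ↦ v) = _
  congr 1
  ext i
  fin_cases i <;> rfl

theorem formToBilin_swap (A : E [⋀^Fin 2]→L[ℂ] ℂ) (u v : E) :
    formToBilin E A u v = - formToBilin E A v u := by
  rw [formToBilin_apply, formToBilin_apply]
  have h : ![u, v] = ![v, u] ∘ Equiv.swap 0 1 := by
    ext i
    fin_cases i <;> rfl
  rw [h]
  exact A.map_swap ![v, u] Fin.zero_ne_one

theorem analyticAt_clm_comp_add {F G : Type*} [NormedAddCommGroup F] [NormedSpace ℂ F]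
    [NormedAddCommGroup G] [NormedSpace ℂ G] (T : F →L[ℂ] G) {w : E → F} {z₀ : E}
    (hw : AnalyticAt ℂ w z₀) : AnalyticAt ℂ (fun x ↦ T (w (z₀ + x))) 0 :=
  (T.analyticAt _).comp
    (AnalyticAt.comp_of_eq hw (analyticAt_const.add analyticAt_id) (add_zero z₀))

theorem fderiv_clm_comp_add {F G : Type*} [NormedAddCommGroup F] [NormedSpace ℂ F]
    [NormedAddCommGroup G] [NormedSpace ℂ G] (T : F →L[ℂ] G) {w : E → F} {z₀ x : E}
    (hw : DifferentiableAt ℂ w (z₀ + x)) :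
    fderiv ℂ (fun x ↦ T (w (z₀ + x))) x = T.comp (fderiv ℂ w (z₀ + x)) :=
  (T.hasFDerivAt.comp x (HasFDerivAt.comp (f := fun x ↦ z₀ + x) x hw.hasFDerivAt
    ((hasFDerivAt_id x).const_add z₀))).fderiv

theorem cyclic_fderiv_of_extDeriv_eq_zero {w : E → E [⋀^Fin 2]→L[ℂ] ℂ} {x : E}
    (hx : extDeriv w x = 0) (u v z : E) :
    fderiv ℂ w x u ![v, z] - fderiv ℂ w x v ![u, z] + fderiv ℂ w x z ![u, v] = 0 := by
  have h := DFunLike.congr_fun hx ![u, v, z]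
  rw [extDeriv, ContinuousAlternatingMap.alternatizeUncurryFin_apply, Fin.sum_univ_three] at h
  have h0 : Fin.removeNth 0 ![u, v, z] = ![v, z] := by
    ext i; fin_cases i <;> rfl
  have h1 : Fin.removeNth 1 ![u, v, z] = ![u, z] := by
    ext i; fin_cases i <;> rfl
  have h2 : Fin.removeNth 2 ![u, v, z] = ![u, v] := by
    ext i; fin_cases i <;> rfl
  rw [h0, h1, h2] at h
  simpa [sub_eq_add_neg] using h

/-- A closed holomorphic `2`-form that is non-degenerate at a point is locally the pullback of its
value at that point. -/
theorem exists_pullback_eq_const [FiniteDimensional ℂ E] {w : E → E [⋀^Fin 2]→L[ℂ] ℂ} {z₀ : E}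
    (hw : AnalyticAt ℂ w z₀) (hcl : ∀ᶠ z in 𝓝 z₀, extDeriv w z = 0)
    (hnd : ∀ u, u ≠ 0 → ∃ v, w z₀ ![u, v] ≠ 0) :
    ∃ φ : E → E, AnalyticAt ℂ φ 0 ∧ φ 0 = z₀ ∧ HasFDerivAt φ (ContinuousLinearMap.id ℂ E) 0 ∧
      ∀ᶠ x in 𝓝 0, ∀ u v, w (φ x) ![fderiv ℂ φ x u, fderiv ℂ φ x v] = w z₀ ![u, v] := by
  have := FiniteDimensional.complete ℂ E
  let B : E → E →L[ℂ] E →L[ℂ] ℂ := fun x ↦ formToBilin E (w (z₀ + x))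
  have hB : AnalyticAt ℂ B 0 :=
    analyticAt_clm_comp_add (G := E →L[ℂ] E →L[ℂ] ℂ) (formToBilin E) hw
  have htend : Filter.Tendsto (fun x : E ↦ z₀ + x) (𝓝 0) (𝓝 z₀) := by
    simpa using (continuous_const_add z₀).tendsto 0
  have hBalt (x u v) : B x u v = - B x v u := formToBilin_swap _ _ _
  have hBcl : ∀ᶠ x in 𝓝 0, ∀ u v z,
      fderiv ℂ B x u v z - fderiv ℂ B x v u z + fderiv ℂ B x z u v = 0 := by
    filter_upwards [htend.eventually hcl, htend.eventually hw.eventually_analyticAt]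
      with x h1 h2 u v z
    have h3 : fderiv ℂ B x = (formToBilin E).comp (fderiv ℂ w (z₀ + x)) :=
      fderiv_clm_comp_add (G := E →L[ℂ] E →L[ℂ] ℂ) (formToBilin E) h2.differentiableAt
    simp only [h3, ContinuousLinearMap.comp_apply, formToBilin_apply]
    exact cyclic_fderiv_of_extDeriv_eq_zero h1 u v z
  have hB0 (u v) : B 0 u v = w z₀ ![u, v] := by
    simp only [B, formToBilin_apply, add_zero]
  have hinj : Function.Injective (B 0) := by
    rw [injective_iff_map_eq_zero]
    intro u hu
    by_contra h
    obtain ⟨v, hv⟩ := hnd u h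
    exact hv (by rw [← hB0, hu]; rfl)
  have hdim : Module.finrank ℂ E = Module.finrank ℂ (E →L[ℂ] ℂ) := by
    rw [← (LinearMap.toContinuousLinearMap (𝕜 := ℂ) (E := E) (F' := ℂ)).finrank_eq]
    exact (Subspace.dual_finrank_eq (K := ℂ) (V := E)).symm
  let B₀ : E ≃L[ℂ] (E →L[ℂ] ℂ) :=
    (LinearEquiv.ofInjectiveOfFinrankEq (B 0).toLinearMap hinj hdim).toContinuousLinearEquiv
  obtain ⟨φ, hφ, hφ0, hφ1, hφB⟩ := exists_analytic_pullback_eq hB B₀ (by ext; rfl)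
    (.of_forall hBalt) hBcl
  refine ⟨fun x ↦ z₀ + φ x, analyticAt_const.add hφ, by simp [hφ0], ?_, ?_⟩
  · rw [← hφ1]
    exact hφ.differentiableAt.hasFDerivAt.const_add z₀
  filter_upwards [hφB] with x h u v
  rw [fderiv_const_add, ← hB0, ← h]
  exact (formToBilin_apply _ _ _).symm

/-- Darboux's theorem for closed holomorphic `2`-forms on open subsets of `ℂ ^ (2 n)`. -/
theorem exists_darboux_map {n : ℕ} {w : CSpace (2 * n) → CSpace (2 * n) [⋀^Fin 2]→L[ℂ] ℂ}
    {z₀ : CSpace (2 * n)} (hw : AnalyticAt ℂ w z₀) (hcl : ∀ᶠ z in 𝓝 z₀, extDeriv w z = 0)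
    (hnd : ∀ u, u ≠ 0 → ∃ v, w z₀ ![u, v] ≠ 0) :
    ∃ (Φ : CSpace (2 * n) → CSpace (2 * n)) (e : CSpace (2 * n) ≃L[ℂ] CSpace (2 * n)),
      AnalyticAt ℂ Φ 0 ∧ Φ 0 = z₀ ∧ HasFDerivAt Φ (e : CSpace (2 * n) →L[ℂ] CSpace (2 * n)) 0 ∧
      ∀ᶠ x in 𝓝 0, ∀ u v, w (Φ x) ![fderiv ℂ Φ x u, fderiv ℂ Φ x v] = stdForm u v := by
  obtain ⟨φ, hφ, hφ0, hφ1, hφw⟩ := exists_pullback_eq_const hw hcl hnd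
  obtain ⟨e, he⟩ := exists_symplectic_coordinates (formToBilin _ (w z₀)) (formToBilin_swap _)
    (by simpa only [formToBilin_apply] using hnd)
  simp only [formToBilin_apply] at he
  have hes : e.symm 0 = 0 := map_zero _
  have hd : ∀ y, DifferentiableAt ℂ φ (e.symm y) → HasFDerivAt (fun y ↦ φ (e.symm y))
      ((fderiv ℂ φ (e.symm y)).comp (e.symm : CSpace (2 * n) →L[ℂ] CSpace (2 * n))) y := fun y hy ↦
    HasFDerivAt.comp (f := fun y ↦ e.symm y) y hy.hasFDerivAt e.symm.hasFDerivAt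
  -- `φ` makes the form constant, and `e.symm` pulls this constant form back to `stdForm`.
  refine ⟨fun y ↦ φ (e.symm y), e.symm, ?_, ?_, ?_, ?_⟩
  · exact AnalyticAt.comp_of_eq hφ (e.symm.analyticAt 0) hes
  · simp [hes, hφ0]
  · refine (hd 0 (by rw [hes]; exact hφ.differentiableAt)).congr_fderiv ?_
    rw [hes, hφ1.fderiv]
    rfl
  · have ht : Filter.Tendsto e.symm (𝓝 0) (𝓝 0) := by
      simpa using e.symm.continuous.tendsto 0
    filter_upwards [ht.eventually hφw, ht.eventually hφ.eventually_analyticAt] with y h1 h2 u v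
    rw [(hd y h2.differentiableAt).fderiv]
    have := h1 (e.symm u) (e.symm v)
    rwa [he, e.apply_symm_apply, e.apply_symm_apply] at this

end Forms

/-! ### Biholomorphisms and change of charts -/

section Charts

/-- A holomorphic map with invertible derivative at a point restricts to a biholomorphism on a
neighbourhood where any given local property holds. -/
theorem exists_biholomorphism {E : Type*} [NormedAddCommGroup E] [NormedSpace ℂ E]
    [CompleteSpace E] {Φ : E → E} {a : E} {e : E ≃L[ℂ] E} (hΦ : AnalyticAt ℂ Φ a)
    (he : HasFDerivAt Φ (e : E →L[ℂ] E) a) {P : E → Prop} (hP : ∀ᶠ x in 𝓝 a, P x) :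
    ∃ R : OpenPartialHomeomorph E E, R ∈ contDiffGroupoid ω 𝓘(ℂ, E) ∧ (R : E → E) = Φ ∧
      a ∈ R.source ∧ ∀ x ∈ R.source, P x := by
  have hω : (ω : WithTop ℕ∞) ≠ 0 := by simp
  let R₀ := hΦ.contDiffAt (n := ω).toOpenPartialHomeomorph Φ he hω
  have ha : a ∈ R₀.source := hΦ.contDiffAt.mem_toOpenPartialHomeomorph_source he hω
  have hsymm : AnalyticAt ℂ R₀.symm (Φ a) := (hΦ.contDiffAt.to_localInverse he hω).analyticAt
  -- The source is shrunk so that both `Φ` and its inverse are analytic throughout, not only at the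
  -- base point.
  obtain ⟨S, hS, hSo, haS⟩ := eventually_nhds_iff.1 (hP.and (hΦ.eventually_analyticAt.and
    (hΦ.continuousAt.eventually hsymm.eventually_analyticAt)))
  refine ⟨R₀.restrOpen S hSo, ?_, rfl, ⟨ha, haS⟩, fun x hx ↦ (hS x hx.2).1⟩
  rw [contDiffGroupoid, mem_groupoid_of_pregroupoid]
  constructor
  · have : ContDiffOn ℂ ω Φ (R₀.restrOpen S hSo).source := fun x hx ↦
      (hS x hx.2).2.1.contDiffAt.contDiffWithinAt
    simpa [contDiffPregroupoid, R₀] using this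
  · have : ContDiffOn ℂ ω R₀.symm (R₀.restrOpen S hSo).target := by
      intro y hy
      have hx := (R₀.restrOpen S hSo).map_target hy
      have h := (hS _ hx.2).2.2
      have hxy : Φ ((R₀.restrOpen S hSo).symm y) = y := (R₀.restrOpen S hSo).right_inv hy
      rw [hxy] at h
      exact h.contDiffAt.contDiffWithinAt
    simpa [contDiffPregroupoid] using this

theorem trans_symm_mem_maximalAtlas {H : Type*} [TopologicalSpace H] {M : Type*}
    [TopologicalSpace M] [ChartedSpace H M] {G : StructureGroupoid H}
    {φ : OpenPartialHomeomorph M H} (hφ : φ ∈ G.maximalAtlas M)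
    {R : OpenPartialHomeomorph H H} (hR : R ∈ G) : φ.trans R.symm ∈ G.maximalAtlas M := by
  intro e' he'
  obtain ⟨h1, h2⟩ := hφ e' he'
  refine ⟨?_, ?_⟩
  · rw [OpenPartialHomeomorph.trans_symm_eq_symm_trans_symm, OpenPartialHomeomorph.symm_symm,
      OpenPartialHomeomorph.trans_assoc]
    exact G.trans hR h1
  · rw [← OpenPartialHomeomorph.trans_assoc]
    exact G.trans h2 (G.symm hR)

variable {m : ℕ} {X : Type*} [TopologicalSpace X] [ChartedSpace (CSpace m) X]

theorem TwoForm.apply_eq_of_eq (Ω : TwoForm m X) {x y : X} (h : x = y) (u v : CSpace m) :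
    (Ω x : CSpace m [⋀^Fin 2]→L[ℂ] ℂ) ![u, v] = (Ω y : CSpace m [⋀^Fin 2]→L[ℂ] ℂ) ![u, v] := by
  subst h; rfl

theorem TwoForm.inChart_apply (Ω : TwoForm m X) (φ : OpenPartialHomeomorph X (CSpace m))
    (z u v : CSpace m) : Ω.inChart φ z ![u, v] = (Ω (φ.symm z) : CSpace m [⋀^Fin 2]→L[ℂ] ℂ)
      ![mfderiv 𝓘(ℂ, CSpace m) 𝓘(ℂ, CSpace m) φ.symm z u,
        mfderiv 𝓘(ℂ, CSpace m) 𝓘(ℂ, CSpace m) φ.symm z v] := by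
  change Ω (φ.symm z) _ = Ω (φ.symm z) _
  congr 1
  ext i
  fin_cases i <;> rfl

theorem mdifferentiable_of_mem_holomorphicCharts {φ : OpenPartialHomeomorph X (CSpace m)}
    (hφ : φ ∈ holomorphicCharts m X) : φ.MDifferentiable 𝓘(ℂ, CSpace m) 𝓘(ℂ, CSpace m) :=
  ⟨(contMDiffOn_of_mem_maximalAtlas hφ).mdifferentiableOn (by simp),
    (contMDiffOn_symm_of_mem_maximalAtlas hφ).mdifferentiableOn (by simp)⟩

/-- A `2`-form is recovered from its expression in a holomorphic chart. -/
theorem TwoForm.apply_eq_inChart (Ω : TwoForm m X) {φ : OpenPartialHomeomorph X (CSpace m)}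
    (hφ : φ ∈ holomorphicCharts m X) {y : X} (hy : y ∈ φ.source)
    (u v : TangentSpace 𝓘(ℂ, CSpace m) y) :
    Ω y ![u, v] = Ω.inChart φ (φ y) ![mvfderiv 𝓘(ℂ, CSpace m) φ y u,
      mvfderiv 𝓘(ℂ, CSpace m) φ y v] := by
  have h := (mdifferentiable_of_mem_holomorphicCharts hφ).symm_comp_deriv hy
  have h' (u : TangentSpace 𝓘(ℂ, CSpace m) y) :
      (mfderiv 𝓘(ℂ, CSpace m) 𝓘(ℂ, CSpace m) φ.symm (φ y)
        (mvfderiv 𝓘(ℂ, CSpace m) φ y u) : CSpace m) = u :=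
    DFunLike.congr_fun h u
  rw [TwoForm.inChart_apply]
  refine Eq.trans ?_ (congrArg₂ (fun a b : CSpace m ↦
    (Ω (φ.symm (φ y)) : CSpace m [⋀^Fin 2]→L[ℂ] ℂ) ![a, b]) (h' u) (h' v)).symm
  exact (Ω.apply_eq_of_eq (φ.left_inv hy) u v).symm

/-- The change of charts formula for `2`-forms. -/
theorem TwoForm.inChart_trans_symm (Ω : TwoForm m X) {φ : OpenPartialHomeomorph X (CSpace m)}
    (hφ : φ ∈ holomorphicCharts m X) (R : OpenPartialHomeomorph (CSpace m) (CSpace m))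
    {z : CSpace m} (hR : DifferentiableAt ℂ R z) (hz : R z ∈ φ.target) (u v : CSpace m) :
    Ω.inChart (φ.trans R.symm) z ![u, v] =
      Ω.inChart φ (R z) ![fderiv ℂ R z u, fderiv ℂ R z v] := by
  have h : mfderiv 𝓘(ℂ, CSpace m) 𝓘(ℂ, CSpace m) (φ.trans R.symm).symm z =
      (mfderiv 𝓘(ℂ, CSpace m) 𝓘(ℂ, CSpace m) φ.symm (R z)).comp
        (mfderiv 𝓘(ℂ, CSpace m) 𝓘(ℂ, CSpace m) R z) :=
    mfderiv_comp z ((mdifferentiable_of_mem_holomorphicCharts hφ).mdifferentiableAt_symm hz)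
      hR.mdifferentiableAt
  have h' (u : CSpace m) : (mfderiv 𝓘(ℂ, CSpace m) 𝓘(ℂ, CSpace m) (φ.trans R.symm).symm z u :
      CSpace m) = mfderiv 𝓘(ℂ, CSpace m) 𝓘(ℂ, CSpace m) φ.symm (R z) (fderiv ℂ R z u) := by
    rw [mfderiv_eq_fderiv] at h
    exact DFunLike.congr_fun h u
  rw [TwoForm.inChart_apply, TwoForm.inChart_apply]
  exact congrArg₂ (fun a b : CSpace m ↦
    (Ω (φ.symm (R z)) : CSpace m [⋀^Fin 2]→L[ℂ] ℂ) ![a, b]) (h' u) (h' v)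

theorem mvfderiv_apply_coord {ψ : OpenPartialHomeomorph X (CSpace m)}
    (hψ : ψ ∈ holomorphicCharts m X) {y : X} (hy : y ∈ ψ.source) (i : Fin m)
    (u : TangentSpace 𝓘(ℂ, CSpace m) y) :
    mvfderiv 𝓘(ℂ, CSpace m) (fun x ↦ ψ x i) y u = mvfderiv 𝓘(ℂ, CSpace m) ψ y u i := by
  let L : CSpace m →L[ℂ] ℂ := EuclideanSpace.proj i
  have h : mfderiv 𝓘(ℂ, CSpace m) 𝓘(ℂ, ℂ) (L ∘ ψ) y =
      (mfderiv 𝓘(ℂ, CSpace m) 𝓘(ℂ, ℂ) L (ψ y)).comp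
        (mfderiv 𝓘(ℂ, CSpace m) 𝓘(ℂ, CSpace m) ψ y) :=
    mfderiv_comp y L.differentiableAt.mdifferentiableAt
      ((mdifferentiable_of_mem_holomorphicCharts hψ).mdifferentiableAt hy)
  rw [mfderiv_eq_fderiv, L.fderiv] at h
  exact DFunLike.congr_fun h u

end Charts

/-! ### Darboux's theorem on the manifold -/

theorem mainTheorem3 (n : ℕ) {X : Type*} [TopologicalSpace X] [ChartedSpace (CSpace (2 * n)) X]
    [IsManifold 𝓘(ℂ, CSpace (2 * n)) ω X] (Ω : TwoForm (2 * n) X)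
    (hΩ : IsHolomorphicSymplectic Ω) (x : X) :
    ∃ ψ ∈ holomorphicCharts (2 * n) X, x ∈ ψ.source ∧
      ∀ y ∈ ψ.source, Ω y = ∑ j : Fin n,
        wedge (mvfderiv 𝓘(ℂ, CSpace (2 * n)) (coordP ψ j) y)
          (mvfderiv 𝓘(ℂ, CSpace (2 * n)) (coordQ ψ j) y) := by
  set φ := chartAt (CSpace (2 * n)) x with hφdef
  have hx : x ∈ φ.source := mem_chart_source _ x
  have hφ : φ ∈ holomorphicCharts (2 * n) X := IsManifold.chart_mem_maximalAtlas x
  have hz : φ x ∈ φ.target := φ.map_source hx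
  have hφd := mdifferentiable_of_mem_holomorphicCharts hφ
  have hnd : ∀ u, u ≠ 0 → ∃ v, Ω.inChart φ (φ x) ![u, v] ≠ 0 := by
    intro u hu
    have hsurj := hφd.mfderiv_surjective hx
    obtain ⟨u', hu'⟩ := hsurj u
    obtain ⟨w, hw⟩ := hΩ.nondegenerate x u' (by
      rintro rfl
      exact hu (hu'.symm.trans (map_zero _)))
    refine ⟨mvfderiv 𝓘(ℂ, CSpace (2 * n)) φ x w, ?_⟩
    have hu' : mvfderiv 𝓘(ℂ, CSpace (2 * n)) φ x u' = u := hu'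
    rwa [Ω.apply_eq_inChart hφ hx, hu'] at hw
  have hcl : ∀ᶠ z in 𝓝 (φ x), extDeriv (Ω.inChart φ) z = 0 :=
    (φ.open_target.eventually_mem hz).mono (hΩ.closed φ hφ)
  obtain ⟨Φ, e, hΦ, hΦ0, he, hΦw⟩ := exists_darboux_map (hΩ.holomorphic φ hφ _ hz) hcl hnd
  obtain ⟨R, hR, hRΦ, h0, hRP⟩ := exists_biholomorphism hΦ he (hΦw.and
    (hΦ.eventually_analyticAt.and (hΦ.continuousAt.eventually
      (φ.open_target.eventually_mem (hΦ0.symm ▸ hz)))))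
  have hψ : φ.trans R.symm ∈ holomorphicCharts (2 * n) X := trans_symm_mem_maximalAtlas hφ hR
  -- `Φ` maps Darboux coordinates to those of `φ`, so the new chart is `φ` followed by the local
  -- inverse of `Φ`.
  refine ⟨φ.trans R.symm, hψ, ⟨hx, ?_⟩, fun y hy ↦ ?_⟩
  · change φ x ∈ R.target
    rw [← hΦ0, ← hRΦ]
    exact R.map_source h0
  have hyR : φ.trans R.symm y ∈ R.source := R.map_target hy.2
  obtain ⟨h1, h2, h3⟩ := hRP _ hyR
  rw [← hRΦ] at h1 h2 h3
  ext uv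
  obtain ⟨u, v, rfl⟩ : ∃ u v, uv = ![u, v] := ⟨uv 0, uv 1, by
    ext i : 1
    fin_cases i <;> rfl⟩
  rw [Ω.apply_eq_inChart hψ hy, Ω.inChart_trans_symm hφ R h2.differentiableAt h3, h1, stdForm,
    ContinuousAlternatingMap.sum_apply]
  refine Finset.sum_congr rfl fun j _ ↦ ?_
  rw [wedge_apply]
  simp only [coordP, coordQ, id_eq]
  rw [← mvfderiv_apply_coord hψ hy, ← mvfderiv_apply_coord hψ hy, ← mvfderiv_apply_coord hψ hy,
    ← mvfderiv_apply_coord hψ hy]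
  rfl
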